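/- For $\varepsilon,B\ge 0$, call a matrix $X\in\mathbb{R}^{d\times n}$ with columns $\mathbf{x}_1,\dots,\mathbf{x}_n$ *$(\varepsilon,B)$-orthonormal* if, for all $\alpha\neq\beta$ in $\{1,\dots,n\}$, $$\big|\|\mathbf{x}_\alpha\|^2-1\big|\le\varepsilon,\qquad |\mathbf{x}_\alpha^\top\mathbf{x}_\beta|\le\varepsilon,\qquad \|X\|\le B,\qquad \sum_{\alpha=1}^n(\|\mathbf{x}_\alpha\|^2-1)^2\le B^2,$$ where the first, third and fourth conditions are also required when $n=1$. Here $\|\cdot\|$ is the Euclidean norm of vectors and the $\ell_2\to\ell_2$ operator norm of matrices. **Proposition.** For all real $c_0>0$ and $k>0$ there are constants $C,B>0$, depending only on $c_0$ and $k$, such that the following holds. Let $n\ge 1$ and $d_0$ be integers with $d_0\ge c_0 n$, and let $\mathbf{x}_1,\dots,\mathbf{x}_n$ be independent random vectors in $\mathbb{R}^{d_0}$ with $\mathbb{E}[\mathbf{x}_\alpha]=0$ and $\mathbb{E}[\|\mathbf{x}_\alpha\|^2]=1$ for every $\alpha$. Suppose that each vector $\sqrt{d_0}\,\mathbf{x}_\alpha$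 satisfies the convex concentration property $$\mathbb{P}\Big[\big|\varphi(\sqrt{d_0}\,\mathbf{x}_\alpha)-\mathbb{E}\,\varphi(\sqrt{d_0}\,\mathbf{x}_\alpha)\big|\ge t\Big]\le 2e^{-c_0t^2}$$ for every $t>0$ and every convex function $\varphi:\mathbb{R}^{d_0}\to\mathbb{R}$ that is $1$-Lipschitz for the Euclidean norm. Then, with probability at least $1-n^{-k}$, the matrix $X=(\mathbf{x}_1,\dots,\mathbf{x}_n)\in\mathbb{R}^{d_0\times n}$ is $\Big(\sqrt{\tfrac{C\log n}{d_0}},\,B\Big)$-orthonormal. -/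

import Mathlib

open MeasureTheory ProbabilityTheory

/-- The `d × n` matrix whose columns are the vectors `x 0, …, x (n - 1)`. -/
def columnMatrix {d n : ℕ} (x : Fin n → EuclideanSpace ℝ (Fin d)) :
    Matrix (Fin d) (Fin n) ℝ :=
  Matrix.of fun i a => x a i

/-- The column of `X` with index `a`, as a vector of Euclidean space. -/
def euclideanCol {d n : ℕ} (X : Matrix (Fin d) (Fin n) ℝ) (a : Fin n) :
    EuclideanSpace ℝ (Fin d) :=
  WithLp.toLp 2 (fun i => X i a)

section

open scoped Matrix.Norms.L2Operator

/-- `(ε, B)`-orthonormality of a matrix. Vectors carry the Euclidean norm, and `‖X‖` is the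
`ℓ² → ℓ²` operator norm of the matrix `X`. -/
structure IsApproxOrthonormal {d n : ℕ} (ε B : ℝ) (X : Matrix (Fin d) (Fin n) ℝ) : Prop where
  norm_sq_sub_one_le : ∀ a, |‖euclideanCol X a‖ ^ 2 - 1| ≤ ε
  inner_le : ∀ a b, a ≠ b → |inner ℝ (euclideanCol X a) (euclideanCol X b)| ≤ ε
  opNorm_le : ‖X‖ ≤ B
  sum_sq_le : ∑ a, (‖euclideanCol X a‖ ^ 2 - 1) ^ 2 ≤ B ^ 2

end

/-- The convex concentration property, with constant `c`, of a random vector `Y`. -/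
def ConvexConcentration {Ω : Type*} [MeasurableSpace Ω] (μ : Measure Ω) {d : ℕ} (c : ℝ)
    (Y : Ω → EuclideanSpace ℝ (Fin d)) : Prop :=
  ∀ φ : EuclideanSpace ℝ (Fin d) → ℝ, LipschitzWith 1 φ → ConvexOn ℝ Set.univ φ →
    ∀ t : ℝ, 0 < t →
      μ.real {ω | t ≤ |φ (Y ω) - ∫ ω', φ (Y ω') ∂μ|} ≤ 2 * Real.exp (-c * t ^ 2)

section SubgaussianTails

variable {Ω : Type*} [MeasurableSpace Ω] {μ : Measure Ω} [IsProbabilityMeasure μ]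

/-- A random variable with Gaussian tails has a square-exponential moment. -/
theorem lintegral_exp_sq_le_of_tail {c : ℝ} (hc : 0 < c) {X : Ω → ℝ} (hX : AEMeasurable X μ)
    (htail : ∀ t, 0 < t → μ.real {ω | t ≤ |X ω|} ≤ 2 * Real.exp (-c * t ^ 2)) :
    ∫⁻ ω, ENNReal.ofReal (Real.exp (c / 2 * X ω ^ 2)) ∂μ ≤ 3 := by
  rw [lintegral_eq_lintegral_meas_le μ (ae_of_all _ fun ω => (Real.exp_pos _).le) (by fun_prop)]
  have hsplit : Set.Ioi (0 : ℝ) = Set.Ioc 0 1 ∪ Set.Ioi 1 :=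
    (Set.Ioc_union_Ioi_eq_Ioi zero_le_one).symm
  rw [hsplit]
  refine (lintegral_union_le _ _ _).trans ?_
  have h1 : ∫⁻ t in Set.Ioc (0 : ℝ) 1, μ {ω | t ≤ Real.exp (c / 2 * X ω ^ 2)} ≤ 1 := by
    calc _ ≤ ∫⁻ _ in Set.Ioc (0 : ℝ) 1, 1 := lintegral_mono fun t => prob_le_one
      _ = 1 := by simp
  have h2 : ∫⁻ t in Set.Ioi (1 : ℝ), μ {ω | t ≤ Real.exp (c / 2 * X ω ^ 2)} ≤ 2 := by
    calc _ ≤ ∫⁻ t in Set.Ioi (1 : ℝ), ENNReal.ofReal (2 * t ^ (-2 : ℝ)) := by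
          refine setLIntegral_mono' measurableSet_Ioi fun t ht => ?_
          have ht1 : (1 : ℝ) < t := ht
          have hlog : 0 < Real.log t := Real.log_pos ht1
          have hpos : 0 < Real.log t / (c / 2) := by positivity
          have hb := htail _ (Real.sqrt_pos.2 hpos)
          rw [Real.sq_sqrt hpos.le] at hb
          have he : Real.exp (-c * (Real.log t / (c / 2))) = t ^ (-2 : ℝ) := by
            rw [Real.rpow_def_of_pos (by linarith)]
            congr 1
            field_simp
          rw [he] at hb
          refine le_trans (measure_mono ?_) ((ENNReal.le_ofReal_iff_toReal_le
            (measure_ne_top μ _) (by positivity)).2 hb)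
          intro ω hω
          have hle : Real.log t ≤ c / 2 * X ω ^ 2 := by
            rw [Real.log_le_iff_le_exp (by linarith)]; exact hω
          change √(Real.log t / (c / 2)) ≤ |X ω|
          rw [← Real.sqrt_sq_eq_abs]
          apply Real.sqrt_le_sqrt
          rw [div_le_iff₀ (by positivity)]
          linarith
      _ = 2 := by
          rw [← ofReal_integral_eq_lintegral_ofReal]
          · rw [integral_const_mul, integral_Ioi_rpow_of_lt (by norm_num) one_pos]
            norm_num
          · exact (integrableOn_Ioi_rpow_of_lt (by norm_num) one_pos).const_mul 2
          · filter_upwards [ae_restrict_mem measurableSet_Ioi] with t ht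
            have : (0 : ℝ) < t := lt_trans one_pos ht
            simp only [Pi.zero_apply]
            positivity
  calc _ ≤ (1 : ENNReal) + 2 := add_le_add h1 h2
    _ = 3 := by norm_num

theorem integrable_exp_sq_of_tail {c : ℝ} (hc : 0 < c) {X : Ω → ℝ} (hX : AEMeasurable X μ)
    (htail : ∀ t, 0 < t → μ.real {ω | t ≤ |X ω|} ≤ 2 * Real.exp (-c * t ^ 2)) :
    Integrable (fun ω => Real.exp (c / 2 * X ω ^ 2)) μ := by
  have hm : AEMeasurable (fun ω => Real.exp (c / 2 * X ω ^ 2)) μ := by fun_prop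
  refine ⟨hm.aestronglyMeasurable, ?_⟩
  rw [hasFiniteIntegral_iff_ofReal (ae_of_all _ fun ω => (Real.exp_pos _).le)]
  exact (lintegral_exp_sq_le_of_tail hc hX htail).trans_lt (by simp)

theorem integral_exp_sq_le_of_tail {c : ℝ} (hc : 0 < c) {X : Ω → ℝ} (hX : AEMeasurable X μ)
    (htail : ∀ t, 0 < t → μ.real {ω | t ≤ |X ω|} ≤ 2 * Real.exp (-c * t ^ 2)) :
    ∫ ω, Real.exp (c / 2 * X ω ^ 2) ∂μ ≤ 3 := by
  have hm : AEMeasurable (fun ω => Real.exp (c / 2 * X ω ^ 2)) μ := by fun_prop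
  rw [integral_eq_lintegral_of_nonneg_ae (ae_of_all _ fun ω => (Real.exp_pos _).le)
    hm.aestronglyMeasurable]
  exact ENNReal.toReal_le_of_le_ofReal (by norm_num)
    ((lintegral_exp_sq_le_of_tail hc hX htail).trans (by simp))

theorem Real.exp_le_one_add_add_sq_mul_exp_abs (x : ℝ) :
    Real.exp x ≤ 1 + x + x ^ 2 * Real.exp |x| := by
  have h := Complex.norm_exp_sub_sum_le_norm_mul_exp (x : ℂ) 2
  have h2 : Complex.exp x - ∑ m ∈ Finset.range 2, (x : ℂ) ^ m / m.factorial
      = ((Real.exp x - (1 + x) : ℝ) : ℂ) := by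
    simp [Finset.sum_range_succ]
  rw [h2, Complex.norm_real, Complex.norm_real, Real.norm_eq_abs, Real.norm_eq_abs, sq_abs] at h
  linarith [le_abs_self (Real.exp x - (1 + x))]

/-- A pointwise bound of an exponential by a square-exponential. -/
theorem Real.exp_mul_le_of_pos {a : ℝ} (ha : 0 < a) (t x : ℝ) :
    Real.exp (t * x) ≤
      1 + t * x + t ^ 2 * (2 / a) * Real.exp (t ^ 2 / (2 * a)) * Real.exp (a * x ^ 2) := by
  refine (Real.exp_le_one_add_add_sq_mul_exp_abs (t * x)).trans ?_
  have h1 : x ^ 2 ≤ 2 / a * Real.exp (a * x ^ 2 / 2) := by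
    have := Real.add_one_le_exp (a * x ^ 2 / 2)
    rw [div_mul_eq_mul_div, le_div_iff₀ ha]
    linarith
  have h2 : |t * x| ≤ t ^ 2 / (2 * a) + a * x ^ 2 / 2 := by
    have h3 : t ^ 2 / (2 * a) + a * x ^ 2 / 2 - |t * x| = (|t| - a * |x|) ^ 2 / (2 * a) := by
      rw [abs_mul, sub_sq, mul_pow, sq_abs, sq_abs]
      field_simp
      ring
    have : 0 ≤ (|t| - a * |x|) ^ 2 / (2 * a) := by positivity
    linarith
  have h4 : Real.exp |t * x| ≤ Real.exp (t ^ 2 / (2 * a)) * Real.exp (a * x ^ 2 / 2) := by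
    rw [← Real.exp_add]; exact Real.exp_le_exp.2 h2
  have h5 : Real.exp (a * x ^ 2) = Real.exp (a * x ^ 2 / 2) * Real.exp (a * x ^ 2 / 2) := by
    rw [← Real.exp_add]; congr 1; ring
  have h6 : (t * x) ^ 2 * Real.exp |t * x| ≤
      (t ^ 2 * (2 / a * Real.exp (a * x ^ 2 / 2))) *
        (Real.exp (t ^ 2 / (2 * a)) * Real.exp (a * x ^ 2 / 2)) := by
    rw [mul_pow]
    gcongr
  rw [h5]
  linarith

/-- A centered random variable with Gaussian tails has a sub-Gaussian moment generating
function. -/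
theorem hasSubgaussianMGF_of_tail {c : ℝ} (hc : 0 < c) {X : Ω → ℝ} (hX : Integrable X μ)
    (hmean : ∫ ω, X ω ∂μ = 0)
    (htail : ∀ t, 0 < t → μ.real {ω | t ≤ |X ω|} ≤ 2 * Real.exp (-c * t ^ 2)) :
    HasSubgaussianMGF X (Real.toNNReal (26 / c)) μ := by
  have ha : 0 < c / 2 := by positivity
  have hint := integrable_exp_sq_of_tail hc hX.aemeasurable htail
  have hle := integral_exp_sq_le_of_tail hc hX.aemeasurable htail
  have hbound : ∀ t, Integrable (fun ω => 1 + t * X ω + t ^ 2 * (2 / (c / 2)) *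
      Real.exp (t ^ 2 / (2 * (c / 2))) * Real.exp (c / 2 * X ω ^ 2)) μ := fun t =>
    ((integrable_const 1).add (hX.const_mul t)).add (hint.const_mul _)
  have hexp : ∀ t, Integrable (fun ω => Real.exp (t * X ω)) μ := fun t => by
    have hXm := hX.aemeasurable
    refine (hbound t).mono' (AEMeasurable.aestronglyMeasurable (by fun_prop))
      (ae_of_all _ fun ω => ?_)
    rw [Real.norm_eq_abs, Real.abs_exp]
    exact Real.exp_mul_le_of_pos ha t (X ω)
  refine ⟨hexp, fun t => ?_⟩
  rw [Real.coe_toNNReal _ (by positivity)]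
  have h1 : mgf X μ t ≤ 1 + t ^ 2 * (2 / (c / 2)) * Real.exp (t ^ 2 / (2 * (c / 2))) * 3 := by
    calc mgf X μ t ≤ _ := integral_mono (hexp t) (hbound t)
          fun ω => Real.exp_mul_le_of_pos ha t (X ω)
      _ = 1 + t ^ 2 * (2 / (c / 2)) * Real.exp (t ^ 2 / (2 * (c / 2))) *
            ∫ ω, Real.exp (c / 2 * X ω ^ 2) ∂μ := by
          have hlin : Integrable (fun ω => 1 + t * X ω) μ :=
            (integrable_const 1).add (hX.const_mul t)
          rw [integral_add hlin (hint.const_mul _),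
            integral_add (integrable_const 1) (hX.const_mul t), integral_const_mul,
            integral_const_mul, hmean]
          simp
      _ ≤ _ := by gcongr
  refine h1.trans ?_
  have hz : 0 ≤ t ^ 2 / (2 * (c / 2)) := by positivity
  have hz' := Real.one_le_exp hz
  have hy : 0 ≤ t ^ 2 * (2 / (c / 2)) * 3 := by positivity
  calc 1 + t ^ 2 * (2 / (c / 2)) * Real.exp (t ^ 2 / (2 * (c / 2))) * 3
      ≤ (t ^ 2 * (2 / (c / 2)) * 3 + 1) * Real.exp (t ^ 2 / (2 * (c / 2))) := by linarith
    _ ≤ Real.exp (t ^ 2 * (2 / (c / 2)) * 3) * Real.exp (t ^ 2 / (2 * (c / 2))) := by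
        gcongr
        exact Real.add_one_le_exp _
    _ = Real.exp (26 / c * t ^ 2 / 2) := by
        rw [← Real.exp_add]
        congr 1
        field_simp
        ring

theorem integral_sq_le_of_tail {c : ℝ} (hc : 0 < c) {X : Ω → ℝ} (hX : AEMeasurable X μ)
    (htail : ∀ t, 0 < t → μ.real {ω | t ≤ |X ω|} ≤ 2 * Real.exp (-c * t ^ 2)) :
    ∫ ω, X ω ^ 2 ∂μ ≤ 6 / c := by
  have hint := integrable_exp_sq_of_tail hc hX htail
  calc ∫ ω, X ω ^ 2 ∂μ ≤ ∫ ω, 2 / c * Real.exp (c / 2 * X ω ^ 2) ∂μ := by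
        refine integral_mono_of_nonneg (ae_of_all _ fun ω => sq_nonneg _) (hint.const_mul _)
          (ae_of_all _ fun ω => ?_)
        have := Real.add_one_le_exp (c / 2 * X ω ^ 2)
        simp only
        rw [div_mul_eq_mul_div, le_div_iff₀ hc]
        linarith
    _ ≤ 2 / c * 3 := by
        rw [integral_const_mul]
        gcongr
        exact integral_exp_sq_le_of_tail hc hX htail
    _ = 6 / c := by ring

/-- A Chernoff bound for sums of squares of independent variables with Gaussian tails. -/
theorem measureReal_sum_sq_ge_le {ι : Type*} [Fintype ι] {c : ℝ} (hc : 0 < c) {X : ι → Ω → ℝ}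
    (hX : ∀ i, Measurable (X i)) (hindep : iIndepFun X μ)
    (htail : ∀ i t, 0 < t → μ.real {ω | t ≤ |X i ω|} ≤ 2 * Real.exp (-c * t ^ 2)) (s : ℝ) :
    μ.real {ω | s ≤ ∑ i, X i ω ^ 2} ≤
      Real.exp (-(c / 2) * s) * 3 ^ Fintype.card ι := by
  have hind : iIndepFun (fun i ω => X i ω ^ 2) μ :=
    hindep.comp (fun _ x => x ^ 2) fun _ => by fun_prop
  have hint : Integrable (fun ω => Real.exp (c / 2 * (∑ i, fun ω => X i ω ^ 2) ω)) μ :=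
    hind.integrable_exp_mul_sum (fun i => by have := hX i; fun_prop)
      fun i _ => integrable_exp_sq_of_tail hc (hX i).aemeasurable (htail i)
  have h := measure_ge_le_exp_mul_mgf (μ := μ) s (by positivity : 0 ≤ c / 2) hint
  rw [hind.mgf_sum (fun i => by have := hX i; fun_prop)] at h
  simp only [Finset.sum_apply] at h
  refine h.trans ?_
  gcongr
  calc _ ≤ ∏ _i : ι, (3 : ℝ) := Finset.prod_le_prod (fun i _ => mgf_nonneg)
        fun i _ => integral_exp_sq_le_of_tail hc (hX i).aemeasurable (htail i)
    _ = _ := by simp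

end SubgaussianTails

section Nets

/-- The closed unit ball of a finite-dimensional space has a `1/2`-net of cardinality at most
`5 ^ dim`. -/
theorem exists_half_net (E : Type*) [NormedAddCommGroup E] [NormedSpace ℝ E]
    [FiniteDimensional ℝ E] :
    ∃ N : Finset E, N.card ≤ 5 ^ Module.finrank ℝ E ∧ (∀ v ∈ N, ‖v‖ ≤ 1) ∧
      ∀ v : E, ‖v‖ ≤ 1 → ∃ w ∈ N, ‖v - w‖ ≤ 1 / 2 := by
  classical
  let P : Finset E → Prop := fun s =>
    (∀ c ∈ s, ‖c‖ ≤ 2) ∧ ∀ c ∈ s, ∀ d ∈ s, c ≠ d → 1 ≤ ‖c - d‖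
  have hcard : ∀ s, P s → s.card ≤ 5 ^ Module.finrank ℝ E := fun s hs =>
    Besicovitch.card_le_of_separated s hs.1 hs.2
  let Q : ℕ → Prop := fun m => ∃ s, P s ∧ s.card = m
  have hQ0 : Q 0 := ⟨∅, by simp [P], rfl⟩
  obtain ⟨s, hs, hsm⟩ : Q (Nat.findGreatest Q (5 ^ Module.finrank ℝ E)) :=
    Nat.findGreatest_spec (Nat.zero_le _) hQ0
  have hcover : ∀ v : E, ‖v‖ ≤ 2 → ∃ w ∈ s, ‖v - w‖ ≤ 1 := by
    intro v hv
    by_contra! hfar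
    have hvs : v ∉ s := fun h => by
      have := hfar v h
      simp at this
      linarith
    have hP : P (insert v s) := by
      refine ⟨?_, ?_⟩
      · intro c hc
        rcases Finset.mem_insert.1 hc with rfl | hc
        exacts [hv, hs.1 c hc]
      · intro c hc d hd hne
        rcases Finset.mem_insert.1 hc with hcv | hc
        · rcases Finset.mem_insert.1 hd with hdv | hd
          · exact absurd (hcv.trans hdv.symm) hne
          · rw [hcv]; exact (hfar d hd).le
        · rcases Finset.mem_insert.1 hd with hdv | hd
          · rw [hdv, norm_sub_rev]; exact (hfar c hc).le
          · exact hs.2 c hc d hd hne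
    have hQ : Q (insert v s).card := ⟨_, hP, rfl⟩
    have hle := Nat.le_findGreatest (hcard _ hP) hQ
    rw [Finset.card_insert_of_notMem hvs] at hle
    omega
  refine ⟨s.image fun v => (1 / 2 : ℝ) • v, Finset.card_image_le.trans (hcard s hs), ?_, ?_⟩
  · intro v hv
    obtain ⟨w, hw, rfl⟩ := Finset.mem_image.1 hv
    have := hs.1 w hw
    rw [norm_smul]
    norm_num
    linarith
  · intro v hv
    obtain ⟨w, hw, hvw⟩ := hcover ((2 : ℝ) • v) (by rw [norm_smul]; norm_num; linarith)
    refine ⟨_, Finset.mem_image_of_mem _ hw, ?_⟩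
    have : v - (1 / 2 : ℝ) • w = (1 / 2 : ℝ) • ((2 : ℝ) • v - w) := by
      rw [smul_sub, smul_smul]; norm_num
    rw [this, norm_smul]
    norm_num
    linarith

theorem norm_le_of_half_net {F : Type*} [NormedAddCommGroup F] [InnerProductSpace ℝ F]
    {N : Set F} (hN : ∀ u : F, ‖u‖ ≤ 1 → ∃ w ∈ N, ‖u - w‖ ≤ 1 / 2) {M : ℝ} (x : F)
    (h : ∀ u ∈ N, |inner ℝ u x| ≤ M) : ‖x‖ ≤ 2 * M := by
  rcases eq_or_ne x 0 with rfl | hx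
  · obtain ⟨w, hw, -⟩ := hN 0 (by simp)
    simpa using (abs_nonneg _).trans (h w hw)
  have hx0 : 0 < ‖x‖ := norm_pos_iff.2 hx
  obtain ⟨w, hw, hwu⟩ := hN (‖x‖⁻¹ • x) (by rw [norm_smul]; simp [hx0.ne'])
  have h1 : inner ℝ (‖x‖⁻¹ • x) x = ‖x‖ := by
    rw [real_inner_smul_left, real_inner_self_eq_norm_sq]
    field_simp
  have h2 : inner ℝ (‖x‖⁻¹ • x) x = inner ℝ w x + inner ℝ (‖x‖⁻¹ • x - w) x := by
    rw [inner_sub_left]; ring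
  have h3 := real_inner_le_norm (‖x‖⁻¹ • x - w) x
  have h4 : ‖‖x‖⁻¹ • x - w‖ * ‖x‖ ≤ 1 / 2 * ‖x‖ := by gcongr
  have h5 := (le_abs_self _).trans (h w hw)
  linarith

theorem opNorm_le_of_half_net {E F : Type*} [NormedAddCommGroup E] [NormedSpace ℝ E]
    [NormedAddCommGroup F] [InnerProductSpace ℝ F] {N : Set E} {N' : Set F}
    (hN : ∀ v : E, ‖v‖ ≤ 1 → ∃ w ∈ N, ‖v - w‖ ≤ 1 / 2)
    (hN' : ∀ u : F, ‖u‖ ≤ 1 → ∃ w ∈ N', ‖u - w‖ ≤ 1 / 2) {M : ℝ} (hM : 0 ≤ M) (A : E →L[ℝ] F)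
    (h : ∀ v ∈ N, ∀ u ∈ N', |inner ℝ u (A v)| ≤ M) : ‖A‖ ≤ 4 * M := by
  have hA : ‖A‖ ≤ 2 * M + ‖A‖ / 2 := by
    refine A.opNorm_le_of_unit_norm (by positivity) fun v hv => ?_
    obtain ⟨w, hw, hvw⟩ := hN v hv.le
    have h1 : ‖A w‖ ≤ 2 * M := norm_le_of_half_net hN' _ (h w hw)
    have h2 : ‖A (v - w)‖ ≤ ‖A‖ * (1 / 2) := A.le_opNorm_of_le hvw
    have h3 : A v = A w + A (v - w) := by rw [map_sub]; abel
    rw [h3]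
    linarith [norm_add_le (A w) (A (v - w))]
  linarith

open scoped Matrix.Norms.L2Operator in
theorem norm_columnMatrix_le_of_half_net {d n : ℕ} (x : Fin n → EuclideanSpace ℝ (Fin d))
    {N : Set (EuclideanSpace ℝ (Fin n))} {N' : Set (EuclideanSpace ℝ (Fin d))}
    (hN : ∀ v, ‖v‖ ≤ 1 → ∃ w ∈ N, ‖v - w‖ ≤ 1 / 2)
    (hN' : ∀ u, ‖u‖ ≤ 1 → ∃ w ∈ N', ‖u - w‖ ≤ 1 / 2) {M : ℝ} (hM : 0 ≤ M)
    (h : ∀ v ∈ N, ∀ u ∈ N', |∑ a, v a * inner ℝ u (x a)| ≤ M) :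
    ‖columnMatrix x‖ ≤ 4 * M := by
  rw [Matrix.l2_opNorm_def]
  refine opNorm_le_of_half_net hN hN' hM _ fun v hv u hu => ?_
  convert h v hv u hu using 2
  have : (LinearEquiv.trans (Matrix.toEuclideanLin (𝕜 := ℝ) (m := Fin d) (n := Fin n))
      LinearMap.toContinuousLinearMap (columnMatrix x)) v = ∑ a, v a • x a := by
    ext i
    simp [Matrix.toLpLin_apply, Matrix.mulVec, dotProduct, columnMatrix, mul_comm]
  rw [this, inner_sum]
  simp [real_inner_smul_right]

end Nets

section Projections

variable {Ω : Type*} [MeasurableSpace Ω] {μ : Measure Ω} {d : ℕ}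

theorem ConvexConcentration.inner_tail {c : ℝ} {Y : Ω → EuclideanSpace ℝ (Fin d)}
    (hY : ConvexConcentration μ c Y) (hint : Integrable Y μ) (hmean : ∫ ω, Y ω ∂μ = 0)
    {u : EuclideanSpace ℝ (Fin d)} (hu : ‖u‖ ≤ 1) (t : ℝ) (ht : 0 < t) :
    μ.real {ω | t ≤ |inner ℝ u (Y ω)|} ≤ 2 * Real.exp (-c * t ^ 2) := by
  have hlip : LipschitzWith 1 fun y : EuclideanSpace ℝ (Fin d) => inner ℝ u y := by
    refine LipschitzWith.of_dist_le_mul fun y z => ?_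
    rw [Real.dist_eq, ← inner_sub_right, NNReal.coe_one, dist_eq_norm]
    exact (abs_real_inner_le_norm _ _).trans
      (mul_le_mul_of_nonneg_right hu (norm_nonneg _))
  have h := hY _ hlip ((innerSL ℝ u).toLinearMap.convexOn convex_univ) t ht
  have h0 : ∫ ω, inner ℝ u (Y ω) ∂μ = 0 := by
    rw [integral_inner hint, hmean, inner_zero_right]
  simpa [h0] using h

theorem ConvexConcentration.norm_tail {c : ℝ} {Y : Ω → EuclideanSpace ℝ (Fin d)}
    (hY : ConvexConcentration μ c Y) (t : ℝ) (ht : 0 < t) :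
    μ.real {ω | t ≤ |‖Y ω‖ - ∫ ω', ‖Y ω'‖ ∂μ|} ≤ 2 * Real.exp (-c * t ^ 2) :=
  hY _ lipschitzWith_one_norm convexOn_univ_norm t ht

/-- The bilinear form of independent centered vectors is sub-Gaussian. -/
theorem measureReal_bilinear_ge_le [IsProbabilityMeasure μ] {n : ℕ} {c : ℝ} (hc : 0 < c)
    {Y : Fin n → Ω → EuclideanSpace ℝ (Fin d)} (hind : iIndepFun Y μ)
    (hint : ∀ a, Integrable (Y a) μ) (hmean : ∀ a, ∫ ω, Y a ω ∂μ = 0)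
    (hY : ∀ a, ConvexConcentration μ c (Y a))
    {v : EuclideanSpace ℝ (Fin n)} (hv : ‖v‖ ≤ 1)
    {u : EuclideanSpace ℝ (Fin d)} (hu : ‖u‖ ≤ 1) {s : ℝ} (hs : 0 ≤ s) :
    μ.real {ω | s ≤ |∑ a, v a * inner ℝ u (Y a ω)|} ≤ 2 * Real.exp (-(c / 52) * s ^ 2) := by
  have hsub : ∀ a, HasSubgaussianMGF (fun ω => v a * inner ℝ u (Y a ω))
      (Real.toNNReal (v a ^ 2) * Real.toNNReal (26 / c)) μ := fun a => by
    rw [Real.toNNReal_of_nonneg (sq_nonneg (v a))]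
    exact (hasSubgaussianMGF_of_tail hc ((hint a).const_inner u)
        (by rw [integral_inner (hint a), hmean a, inner_zero_right])
        ((hY a).inner_tail (hint a) (hmean a) hu)).const_mul (v a)
  have hindep : iIndepFun (fun a ω => v a * inner ℝ u (Y a ω)) μ :=
    hind.comp (fun a y => v a * inner ℝ u y) fun a => by fun_prop
  have hsum := HasSubgaussianMGF.sum_of_iIndepFun hindep (s := Finset.univ) fun a _ => hsub a
  have hle : ((∑ a, Real.toNNReal (v a ^ 2) * Real.toNNReal (26 / c) : NNReal) : ℝ)
      ≤ 26 / c := by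
    push_cast
    simp_rw [Real.coe_toNNReal _ (sq_nonneg _)]
    rw [Real.coe_toNNReal _ (by positivity), ← Finset.sum_mul]
    have h1 : ∑ a, v a ^ 2 ≤ 1 := by
      rw [← EuclideanSpace.real_norm_sq_eq]
      exact pow_le_one₀ (norm_nonneg _) hv
    calc _ ≤ 1 * (26 / c) := by
          gcongr
      _ = _ := one_mul _
  have hsum' : HasSubgaussianMGF (fun ω => ∑ a, v a * inner ℝ u (Y a ω))
      (Real.toNNReal (26 / c)) μ := by
    refine ⟨hsum.integrable_exp_mul, fun t => (hsum.mgf_le t).trans ?_⟩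
    rw [Real.coe_toNNReal _ (by positivity)]
    gcongr
  have hexp : Real.exp (-s ^ 2 / (2 * (Real.toNNReal (26 / c) : ℝ)))
      = Real.exp (-(c / 52) * s ^ 2) := by
    rw [Real.coe_toNNReal _ (by positivity)]
    congr 1
    field_simp
    ring
  have h1 := hsum'.measure_ge_le hs
  have h2 := hsum'.neg.measure_ge_le hs
  rw [hexp] at h1 h2
  calc _ ≤ μ.real ({ω | s ≤ ∑ a, v a * inner ℝ u (Y a ω)} ∪
          {ω | s ≤ (-fun ω => ∑ a, v a * inner ℝ u (Y a ω)) ω}) := by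
        refine measureReal_mono fun ω hω => ?_
        have h : s ≤ |∑ a, v a * inner ℝ u (Y a ω)| := hω
        exact le_abs.1 h
    _ ≤ _ := measureReal_union_le _ _
    _ ≤ _ := by linarith

/-- Inner products of two independent centered vectors concentrate where one of them is
bounded. -/
theorem measureReal_inner_ge_le [IsProbabilityMeasure μ] {c : ℝ}
    {Y Z : Ω → EuclideanSpace ℝ (Fin d)} (hYm : Measurable Y) (hZm : Measurable Z)
    (hind : IndepFun Y Z μ) (hint : Integrable Y μ) (hmean : ∫ ω, Y ω ∂μ = 0)
    (hY : ConvexConcentration μ c Y) {R s : ℝ} (hR : 0 < R) (hs : 0 < s) :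
    μ.real {ω | s ≤ |inner ℝ (Z ω) (Y ω)| ∧ ‖Z ω‖ ≤ R} ≤ 2 * Real.exp (-c * (s / R) ^ 2) := by
  have hS : MeasurableSet {p : EuclideanSpace ℝ (Fin d) × EuclideanSpace ℝ (Fin d) |
      s ≤ |inner ℝ p.2 p.1| ∧ ‖p.2‖ ≤ R} := by
    have h1 : IsClosed {p : EuclideanSpace ℝ (Fin d) × EuclideanSpace ℝ (Fin d) |
        s ≤ |inner ℝ p.2 p.1|} := isClosed_le continuous_const (by fun_prop)
    have h2 : IsClosed {p : EuclideanSpace ℝ (Fin d) × EuclideanSpace ℝ (Fin d) |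
        ‖p.2‖ ≤ R} := isClosed_le (by fun_prop) continuous_const
    exact (h1.inter h2).measurableSet
  have hmap := (indepFun_iff_map_prod_eq_prod_map_map hYm.aemeasurable hZm.aemeasurable).1 hind
  have hpY : IsProbabilityMeasure (μ.map Y) := Measure.isProbabilityMeasure_map hYm.aemeasurable
  have hpZ : IsProbabilityMeasure (μ.map Z) := Measure.isProbabilityMeasure_map hZm.aemeasurable
  refine ENNReal.toReal_le_of_le_ofReal (by positivity) ?_
  have heq : μ {ω | s ≤ |inner ℝ (Z ω) (Y ω)| ∧ ‖Z ω‖ ≤ R}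
      = μ.map (fun ω => (Y ω, Z ω)) {p | s ≤ |inner ℝ p.2 p.1| ∧ ‖p.2‖ ≤ R} := by
    rw [Measure.map_apply (hYm.prodMk hZm) hS]
    rfl
  rw [heq, hmap, Measure.prod_apply_symm hS]
  calc _ ≤ ∫⁻ _, ENNReal.ofReal (2 * Real.exp (-c * (s / R) ^ 2)) ∂(μ.map Z) := by
        refine lintegral_mono fun z => ?_
        rw [Measure.map_apply hYm (measurable_prodMk_right hS)]
        by_cases hz : ‖z‖ ≤ R
        · have hu : ‖R⁻¹ • z‖ ≤ 1 := by
            rw [norm_smul, norm_inv, Real.norm_of_nonneg hR.le, inv_mul_le_iff₀ hR]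
            simpa using hz
          refine le_trans (measure_mono ?_) ((ENNReal.le_ofReal_iff_toReal_le
            (measure_ne_top μ _) (by positivity)).2
              (hY.inner_tail hint hmean hu (s / R) (by positivity)))
          intro ω hω
          have h1 : s ≤ |inner ℝ z (Y ω)| := hω.1
          change s / R ≤ |inner ℝ (R⁻¹ • z) (Y ω)|
          rw [real_inner_smul_left, abs_mul, abs_of_pos (inv_pos.2 hR), div_eq_inv_mul]
          gcongr
        · have : Y ⁻¹' ((fun y => (y, z)) ⁻¹' {p : EuclideanSpace ℝ (Fin d) ×
              EuclideanSpace ℝ (Fin d) | s ≤ |inner ℝ p.2 p.1| ∧ ‖p.2‖ ≤ R}) = ∅ := by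
            ext ω
            simp [hz]
          rw [this, measure_empty]
          positivity
    _ = _ := by simp

end Projections

section Deviations

variable {Ω : Type*} [MeasurableSpace Ω] {μ : Measure Ω} [IsProbabilityMeasure μ] {d : ℕ}

theorem sub_sq_integral_norm_mem_Icc {c : ℝ} (hc : 0 < c) {Y : Ω → EuclideanSpace ℝ (Fin d)}
    (hYm : Measurable Y) (hsq : Integrable (fun ω => ‖Y ω‖ ^ 2) μ)
    (hY : ConvexConcentration μ c Y) :
    (∫ ω, ‖Y ω‖ ^ 2 ∂μ) - (∫ ω, ‖Y ω‖ ∂μ) ^ 2 ∈ Set.Icc 0 (6 / c) := by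
  have hL2 : MemLp (fun ω => ‖Y ω‖) 2 μ :=
    (memLp_two_iff_integrable_sq (by fun_prop)).2 hsq
  have hvar := variance_eq_sub hL2
  have hvar' := variance_eq_integral (μ := μ) (X := fun ω => ‖Y ω‖) (by fun_prop)
  simp only [Pi.pow_apply] at hvar
  rw [← hvar]
  refine ⟨variance_nonneg _ _, ?_⟩
  rw [hvar']
  exact integral_sq_le_of_tail hc (by fun_prop) hY.norm_tail

theorem abs_sq_sub_one_le {d m V r : ℝ} (hd : 1 ≤ d) (hm : 0 ≤ m)
    (hV : d - m ^ 2 ∈ Set.Icc 0 V) (hr : 0 ≤ r) :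
    |r ^ 2 - 1| ≤ (r + 1) * ((|√d * r - m| + V) / √d) := by
  have hd1 : 1 ≤ √d := Real.one_le_sqrt.2 hd
  have hsq : √d ^ 2 = d := Real.sq_sqrt (by linarith)
  have hmd : m ≤ √d := Real.le_sqrt_of_sq_le (by linarith [hV.1])
  have h1 : √d - m ≤ V := by
    have : √d - m ≤ (√d - m) * (√d + m) := le_mul_of_one_le_right (by linarith) (by linarith)
    have h2 : (√d - m) * (√d + m) = d - m ^ 2 := by linear_combination hsq
    linarith [hV.2]
  have h3 : r ^ 2 - 1 = (r + 1) * (r - 1) := by ring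
  rw [h3, abs_mul, abs_of_nonneg (by linarith)]
  refine mul_le_mul_of_nonneg_left ?_ (by linarith)
  rw [le_div_iff₀ (by linarith), ← abs_of_pos (by linarith : 0 < √d), ← abs_mul,
    abs_of_pos (by linarith : 0 < √d)]
  have h4 : (r - 1) * √d = (√d * r - m) - (√d - m) := by ring
  rw [h4]
  refine (abs_sub _ _).trans ?_
  rw [abs_of_nonneg (by linarith : 0 ≤ √d - m)]
  linarith

theorem columnMatrix_smul {n : ℕ} (r : ℝ) (x : Fin n → EuclideanSpace ℝ (Fin d)) :
    columnMatrix (fun a => r • x a) = r • columnMatrix x := by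
  ext i a
  simp [columnMatrix]

theorem euclideanCol_columnMatrix {n : ℕ} (x : Fin n → EuclideanSpace ℝ (Fin d)) (a : Fin n) :
    euclideanCol (columnMatrix x) a = x a := by
  ext i
  simp [columnMatrix, euclideanCol]

open scoped Matrix.Norms.L2Operator in
/-- The operator norm of a matrix with independent centered columns is bounded with high
probability. -/
theorem measureReal_norm_columnMatrix_gt_le {n : ℕ} {c : ℝ} (hc : 0 < c)
    {Y : Fin n → Ω → EuclideanSpace ℝ (Fin d)} (hind : iIndepFun Y μ)
    (hint : ∀ a, Integrable (Y a) μ) (hmean : ∀ a, ∫ ω, Y a ω ∂μ = 0)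
    (hY : ∀ a, ConvexConcentration μ c (Y a)) {s : ℝ} (hs : 0 ≤ s) :
    μ.real {ω | 4 * s < ‖columnMatrix fun a => Y a ω‖} ≤
      5 ^ (n + d) * (2 * Real.exp (-(c / 52) * s ^ 2)) := by
  obtain ⟨N, hNc, hN1, hN⟩ := exists_half_net (EuclideanSpace ℝ (Fin n))
  obtain ⟨N', hNc', hN1', hN'⟩ := exists_half_net (EuclideanSpace ℝ (Fin d))
  rw [finrank_euclideanSpace_fin] at hNc hNc'
  calc _ ≤ μ.real (⋃ p ∈ N ×ˢ N', {ω | s ≤ |∑ a, p.1 a * inner ℝ p.2 (Y a ω)|}) := by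
        refine measureReal_mono (fun ω hω => ?_) (measure_ne_top _ _)
        by_contra hcon
        simp only [Set.mem_iUnion, Set.mem_ofPred_eq, not_exists, not_le] at hcon
        refine absurd (norm_columnMatrix_le_of_half_net (fun a => Y a ω) (N := N) (N' := N')
          hN hN' hs fun v hv u hu => ?_) (not_le.2 hω)
        exact (hcon (v, u) (Finset.mem_product.2 ⟨hv, hu⟩)).le
    _ ≤ ∑ p ∈ N ×ˢ N', μ.real {ω | s ≤ |∑ a, p.1 a * inner ℝ p.2 (Y a ω)|} :=
        measureReal_biUnion_finset_le _ _
    _ ≤ ∑ p ∈ N ×ˢ N', 2 * Real.exp (-(c / 52) * s ^ 2) := by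
        refine Finset.sum_le_sum fun p hp => ?_
        obtain ⟨hp1, hp2⟩ := Finset.mem_product.1 hp
        exact measureReal_bilinear_ge_le hc hind hint hmean hY (hN1 _ hp1) (hN1' _ hp2) hs
    _ ≤ _ := by
        rw [Finset.sum_const, nsmul_eq_mul]
        gcongr
        rw [pow_add, Finset.card_product]
        exact_mod_cast Nat.mul_le_mul hNc hNc'

end Deviations

section Main

theorem two_mul_exp_neg_le {n : ℕ} (hn : 2 ≤ n) {k x : ℝ} (hx : (k + 3) * Real.log n ≤ x) :
    2 * Real.exp (-x) ≤ (n : ℝ) ^ (-k) / 4 := by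
  have hn0 : (0 : ℝ) < n := by positivity
  have h8 : (8 : ℝ) ≤ n ^ 3 := by
    have : (2 : ℝ) ≤ n := by exact_mod_cast hn
    calc (8 : ℝ) = 2 ^ 3 := by norm_num
      _ ≤ _ := by gcongr
  have h1 : (n : ℝ) ^ (-k) = (n : ℝ) ^ 3 * Real.exp (-((k + 3) * Real.log n)) := by
    rw [Real.rpow_def_of_pos hn0, ← Real.exp_log (pow_pos hn0 3), ← Real.exp_add, Real.log_pow]
    congr 1
    push_cast
    ring
  have h2 : Real.exp (-x) ≤ Real.exp (-((k + 3) * Real.log n)) := Real.exp_le_exp.2 (by linarith)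
  have h3 := Real.exp_pos (-((k + 3) * Real.log n))
  rw [h1]
  have h4 : 8 * Real.exp (-((k + 3) * Real.log n)) ≤
      (n : ℝ) ^ 3 * Real.exp (-((k + 3) * Real.log n)) := by gcongr
  linarith

open scoped Matrix.Norms.L2Operator in
/-- Approximate orthonormality follows from deviation bounds for the rescaled columns. -/
theorem isApproxOrthonormal_of_deviation_le {n d : ℕ} (hn : 2 ≤ n) {c K V M L C : ℝ}
    (hc : 0 < c) (hK : 0 ≤ K) (hV0 : 0 ≤ V) (hM : 0 ≤ M) (hL : 0 ≤ L)
    (hC : ((1 + √(K / c) + 1) * (√K + 2 * V)) ^ 2 ≤ C)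
    (hd : c * (n : ℝ) ≤ d) {x : Fin n → EuclideanSpace ℝ (Fin d)} {m : Fin n → ℝ}
    (hm : ∀ a, 0 ≤ m a) (hV : ∀ a, (d : ℝ) - m a ^ 2 ∈ Set.Icc 0 V)
    (hnorm : ∀ a, |√d * ‖x a‖ - m a| ≤ √(K * Real.log n))
    (hinner : ∀ a b, a ≠ b → ‖x b‖ ≤ 1 + √(K / c) →
      |inner ℝ (x b) (√(d : ℝ) • x a)| ≤ √(C * Real.log n))
    (hop : ‖columnMatrix fun a => √(d : ℝ) • x a‖ ≤ 4 * √(M * d))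
    (hsum : ∑ a, (√d * ‖x a‖ - m a) ^ 2 ≤ L * n) :
    IsApproxOrthonormal (√(C * Real.log n / d))
      (4 * √M + √(2 * (1 + √(K / c) + 1) ^ 2 * (L + V ^ 2) / c)) (columnMatrix x) := by
  have hn2 : (2 : ℝ) ≤ n := by exact_mod_cast hn
  have hn0 : (0 : ℝ) < n := by linarith
  have hd0 : (0 : ℝ) < d := (mul_pos hc hn0).trans_le hd
  have hd1 : (1 : ℝ) ≤ d := by
    have : 0 < d := by exact_mod_cast hd0
    exact_mod_cast this
  have hsd : 0 < √(d : ℝ) := Real.sqrt_pos.2 hd0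
  have hsq : √(d : ℝ) ^ 2 = d := Real.sq_sqrt hd0.le
  have hlogn : Real.log n ≤ n := (Real.log_le_sub_one_of_pos hn0).trans (by linarith)
  have hlog : 1 / 4 ≤ Real.log n := by
    have := Real.log_two_gt_d9
    have := Real.log_le_log two_pos hn2
    linarith
  have hlog0 : 0 ≤ Real.log n := by linarith
  have hC0 : 0 ≤ C := (sq_nonneg _).trans hC
  have hsqrt : √(K * Real.log n) ≤ √(K / c) * √d := by
    rw [← Real.sqrt_mul (by positivity)]
    apply Real.sqrt_le_sqrt
    rw [div_mul_eq_mul_div, le_div_iff₀ hc]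
    nlinarith [mul_le_mul_of_nonneg_left hlogn (mul_nonneg hK hc.le),
      mul_le_mul_of_nonneg_left hd hK]
  set R := 1 + √(K / c) with hR
  have hR0 : 0 < R := by positivity
  have hxR : ∀ a, ‖x a‖ ≤ R := fun a => by
    have h1 : m a ≤ √d := Real.le_sqrt_of_sq_le (by linarith [(hV a).1])
    have h2 := (le_abs_self _).trans (hnorm a)
    have h3 : √d * ‖x a‖ ≤ √d * R := by rw [hR]; linarith
    exact le_of_mul_le_mul_left h3 hsd
  have hdev : ∀ a, |‖x a‖ ^ 2 - 1| ≤ (R + 1) * ((|√d * ‖x a‖ - m a| + V) / √d) := fun a => by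
    refine (abs_sq_sub_one_le hd1 (hm a) (hV a) (norm_nonneg _)).trans ?_
    gcongr
    exact hxR a
  constructor
  · intro a
    rw [euclideanCol_columnMatrix]
    refine (hdev a).trans ?_
    have h1 : √(K * Real.log n) + V ≤ (√K + 2 * V) * √(Real.log n) := by
      rw [Real.sqrt_mul hK]
      have h2 : 1 / 2 ≤ √(Real.log n) := Real.le_sqrt_of_sq_le (by norm_num; linarith)
      nlinarith
    calc _ ≤ (R + 1) * (((√K + 2 * V) * √(Real.log n)) / √d) := by
          gcongr
          linarith [hnorm a]
      _ = ((R + 1) * (√K + 2 * V)) * √(Real.log n) / √d := by ring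
      _ ≤ √C * √(Real.log n) / √d := by
          gcongr
          exact Real.le_sqrt_of_sq_le hC
      _ = _ := by rw [Real.sqrt_div' _ hd0.le, Real.sqrt_mul hC0]
  · intro a b hab
    rw [euclideanCol_columnMatrix, euclideanCol_columnMatrix]
    have h := hinner a b hab (hxR b)
    rw [real_inner_smul_right, abs_mul, abs_of_pos hsd, real_inner_comm] at h
    rw [Real.sqrt_div' _ hd0.le, le_div_iff₀ hsd]
    linarith
  · rw [columnMatrix_smul, norm_smul, Real.norm_of_nonneg hsd.le, Real.sqrt_mul hM] at hop
    have h1 : ‖columnMatrix x‖ ≤ 4 * √M :=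
      le_of_mul_le_mul_left (hop.trans_eq (by ring)) hsd
    exact h1.trans (le_add_of_nonneg_right (Real.sqrt_nonneg _))
  · simp only [euclideanCol_columnMatrix]
    have h1 : ∀ a, (‖x a‖ ^ 2 - 1) ^ 2 ≤
        2 * (R + 1) ^ 2 / d * ((√d * ‖x a‖ - m a) ^ 2 + V ^ 2) := fun a => by
      rw [← sq_abs (‖x a‖ ^ 2 - 1), ← sq_abs (√d * ‖x a‖ - m a)]
      calc _ ≤ ((R + 1) * ((|√d * ‖x a‖ - m a| + V) / √d)) ^ 2 := by
            gcongr
            exact hdev a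
        _ = (R + 1) ^ 2 / d * (|√d * ‖x a‖ - m a| + V) ^ 2 := by
            rw [mul_pow, div_pow, hsq]; ring
        _ ≤ (R + 1) ^ 2 / d * (2 * (|√d * ‖x a‖ - m a| ^ 2 + V ^ 2)) := by
            gcongr
            exact add_sq_le
        _ = _ := by ring
    calc _ ≤ ∑ a, 2 * (R + 1) ^ 2 / d * ((√d * ‖x a‖ - m a) ^ 2 + V ^ 2) :=
          Finset.sum_le_sum fun a _ => h1 a
      _ = 2 * (R + 1) ^ 2 / d * (∑ a, (√d * ‖x a‖ - m a) ^ 2 + n * V ^ 2) := by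
          rw [← Finset.mul_sum, Finset.sum_add_distrib]; simp
      _ ≤ 2 * (R + 1) ^ 2 / d * (L * n + n * V ^ 2) := by gcongr
      _ = 2 * (R + 1) ^ 2 * (L + V ^ 2) * (n / d) := by ring
      _ ≤ 2 * (R + 1) ^ 2 * (L + V ^ 2) * (1 / c) := by
          refine mul_le_mul_of_nonneg_left ?_ (by positivity)
          rw [div_le_div_iff₀ hd0 hc]
          linarith
      _ = √(2 * (R + 1) ^ 2 * (L + V ^ 2) / c) ^ 2 := by
          rw [Real.sq_sqrt (by positivity)]; ring
      _ ≤ _ := by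
          gcongr
          exact le_add_of_nonneg_left (by positivity)

section Events

variable {Ω : Type*} [MeasurableSpace Ω] {μ : Measure Ω} {n d : ℕ}
  {c k : ℝ} {Y : Fin n → Ω → EuclideanSpace ℝ (Fin d)}

theorem measureReal_exists_norm_deviation_le (hn : 2 ≤ n) (hc : 0 < c) (hk : 0 < k)
    (hY : ∀ a, ConvexConcentration μ c (Y a)) :
    μ.real {ω | ∃ a, √((k + 4) / c * Real.log n) ≤ |‖Y a ω‖ - ∫ ω', ‖Y a ω'‖ ∂μ|} ≤
      (n : ℝ) ^ (-k) / 4 := by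
  have hlog : 0 < Real.log n := Real.log_pos (by exact_mod_cast hn)
  have hn0 : (0 : ℝ) < n := by positivity
  have hset : {ω | ∃ a, √((k + 4) / c * Real.log n) ≤ |‖Y a ω‖ - ∫ ω', ‖Y a ω'‖ ∂μ|} =
      ⋃ a, {ω | √((k + 4) / c * Real.log n) ≤ |‖Y a ω‖ - ∫ ω', ‖Y a ω'‖ ∂μ|} := by
    ext ω; simp
  rw [hset]
  have hpos : 0 < (k + 4) / c * Real.log n := by positivity
  calc _ ≤ ∑ a : Fin n, 2 * Real.exp (-c * √((k + 4) / c * Real.log n) ^ 2) :=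
        (measureReal_iUnion_fintype_le _).trans <| Finset.sum_le_sum fun a _ =>
          (hY a).norm_tail _ (Real.sqrt_pos.2 hpos)
    _ = 2 * Real.exp (-((k + 3) * Real.log n)) := by
        rw [Real.sq_sqrt hpos.le, Finset.sum_const, Finset.card_univ, Fintype.card_fin,
          nsmul_eq_mul, mul_left_comm]
        nth_rw 1 [← Real.exp_log hn0]
        rw [← Real.exp_add]
        congr 2
        field_simp
        ring
    _ ≤ _ := two_mul_exp_neg_le hn le_rfl

theorem measureReal_exists_inner_gt_le [IsProbabilityMeasure μ] (hn : 2 ≤ n)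
    {x : Fin n → Ω → EuclideanSpace ℝ (Fin d)}
    (hx : ∀ a, Measurable (x a)) (hYm : ∀ a, Measurable (Y a))
    (hind : ∀ a b, a ≠ b → IndepFun (Y a) (x b) μ)
    (hint : ∀ a, Integrable (Y a) μ) (hmean : ∀ a, ∫ ω, Y a ω ∂μ = 0)
    (hY : ∀ a, ConvexConcentration μ c (Y a)) {R C : ℝ} (hR : 0 < R) (hC : 0 < C)
    (hCR : (k + 5) * R ^ 2 ≤ c * C) :
    μ.real {ω | ∃ a b, a ≠ b ∧ √(C * Real.log n) ≤ |inner ℝ (x b ω) (Y a ω)| ∧ ‖x b ω‖ ≤ R} ≤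
      (n : ℝ) ^ (-k) / 4 := by
  have hlog : 0 < Real.log n := Real.log_pos (by exact_mod_cast hn)
  have hn0 : (0 : ℝ) < n := by positivity
  have hset : {ω | ∃ a b, a ≠ b ∧ √(C * Real.log n) ≤ |inner ℝ (x b ω) (Y a ω)| ∧
      ‖x b ω‖ ≤ R} = ⋃ p : Fin n × Fin n, {ω | p.1 ≠ p.2 ∧
        √(C * Real.log n) ≤ |inner ℝ (x p.2 ω) (Y p.1 ω)| ∧ ‖x p.2 ω‖ ≤ R} := by
    ext ω; simp
  rw [hset]
  have hpos : 0 < C * Real.log n := by positivity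
  calc _ ≤ ∑ p : Fin n × Fin n, 2 * Real.exp (-((k + 5) * Real.log n)) := by
        refine (measureReal_iUnion_fintype_le _).trans (Finset.sum_le_sum fun p _ => ?_)
        by_cases hp : p.1 = p.2
        · simp only [hp, ne_eq, not_true_eq_false, false_and, Set.ofPred_false, measureReal_empty]
          positivity
        · simp only [ne_eq, hp, not_false_eq_true, true_and]
          refine (measureReal_inner_ge_le (hYm _) (hx _) (hind _ _ hp) (hint _) (hmean _) (hY _)
            hR (Real.sqrt_pos.2 hpos)).trans ?_
          gcongr
          rw [div_pow, Real.sq_sqrt hpos.le, neg_mul, neg_le_neg_iff, ← mul_div_assoc,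
            le_div_iff₀ (by positivity)]
          nlinarith [mul_le_mul_of_nonneg_right hCR hlog.le]
    _ = 2 * Real.exp (-((k + 3) * Real.log n)) := by
        rw [Finset.sum_const, Finset.card_univ, Fintype.card_prod, Fintype.card_fin,
          nsmul_eq_mul, mul_left_comm]
        push_cast
        nth_rw 1 2 [← Real.exp_log hn0]
        rw [← Real.exp_add, ← Real.exp_add]
        congr 2
        ring
    _ ≤ _ := two_mul_exp_neg_le hn le_rfl

open scoped Matrix.Norms.L2Operator in
theorem measureReal_norm_columnMatrix_gt_le_rpow [IsProbabilityMeasure μ] (hn : 2 ≤ n)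
    (hc : 0 < c) (hk : 0 < k)
    (hd : c * (n : ℝ) ≤ d) (hind : iIndepFun Y μ)
    (hint : ∀ a, Integrable (Y a) μ) (hmean : ∀ a, ∫ ω, Y a ω ∂μ = 0)
    (hY : ∀ a, ConvexConcentration μ c (Y a)) :
    μ.real {ω | 4 * √(52 / c * ((k + 5) / c + 2) * d) < ‖columnMatrix fun a => Y a ω‖} ≤
      (n : ℝ) ^ (-k) / 4 := by
  have hn0 : (0 : ℝ) < n := by positivity
  have hlogn : Real.log n ≤ n := (Real.log_le_sub_one_of_pos hn0).trans (by linarith)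
  refine (measureReal_norm_columnMatrix_gt_le hc hind hint hmean hY (Real.sqrt_nonneg _)).trans ?_
  refine le_trans ?_ (two_mul_exp_neg_le hn (le_refl ((k + 3) * Real.log n)))
  have h5 : (5 : ℝ) ^ (n + d) ≤ Real.exp (2 * ((n + d : ℕ) : ℝ)) := by
    have : (5 : ℝ) ≤ Real.exp 2 := by
      have := Real.quadratic_le_exp_of_nonneg (x := 2) (by norm_num)
      norm_num at this
      exact this
    calc (5 : ℝ) ^ (n + d) ≤ Real.exp 2 ^ (n + d) := by gcongr
      _ = _ := by rw [← Real.exp_nat_mul, mul_comm]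
  calc _ ≤ Real.exp (2 * ((n + d : ℕ) : ℝ)) *
          (2 * Real.exp (-(c / 52) * √(52 / c * ((k + 5) / c + 2) * d) ^ 2)) := by gcongr
    _ = 2 * Real.exp (2 * ((n + d : ℕ) : ℝ) - ((k + 5) / c + 2) * d) := by
        rw [Real.sq_sqrt (by positivity), mul_left_comm, ← Real.exp_add]
        congr 2
        field_simp
        ring
    _ ≤ _ := by
        gcongr
        push_cast
        have h1 : (k + 5) * n ≤ (k + 5) / c * d := by
          rw [div_mul_eq_mul_div, le_div_iff₀ hc]
          nlinarith [mul_le_mul_of_nonneg_left hd (by linarith : 0 ≤ k + 5)]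
        have h2 : (k + 3) * Real.log n ≤ (k + 3) * n := by gcongr
        linarith

theorem measureReal_sum_norm_deviation_gt_le [IsProbabilityMeasure μ] (hn : 2 ≤ n)
    (hc : 0 < c) (hk : 0 < k)
    (hYm : ∀ a, Measurable (Y a)) (hind : iIndepFun Y μ)
    (hY : ∀ a, ConvexConcentration μ c (Y a)) :
    μ.real {ω | 2 * (k + 5) / c * n ≤ ∑ a, (‖Y a ω‖ - ∫ ω', ‖Y a ω'‖ ∂μ) ^ 2} ≤
      (n : ℝ) ^ (-k) / 4 := by
  have hn0 : (0 : ℝ) < n := by positivity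
  have hlogn : Real.log n ≤ n := (Real.log_le_sub_one_of_pos hn0).trans (by linarith)
  have hindep : iIndepFun (fun a ω => ‖Y a ω‖ - ∫ ω', ‖Y a ω'‖ ∂μ) μ :=
    hind.comp (fun a y => ‖y‖ - ∫ ω', ‖Y a ω'‖ ∂μ) fun a => by fun_prop
  refine (measureReal_sum_sq_ge_le hc (fun a => by have := hYm a; fun_prop) hindep
    (fun a => (hY a).norm_tail) _).trans ?_
  refine le_trans ?_ (two_mul_exp_neg_le hn (le_refl ((k + 3) * Real.log n)))
  have h3 : (3 : ℝ) ^ n ≤ Real.exp (2 * n) := by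
    have : (3 : ℝ) ≤ Real.exp 2 := by
      have := Real.add_one_le_exp 2
      norm_num at this
      exact this
    calc (3 : ℝ) ^ n ≤ Real.exp 2 ^ n := by gcongr
      _ = _ := by rw [← Real.exp_nat_mul, mul_comm]
  rw [Fintype.card_fin]
  calc _ ≤ Real.exp (-(c / 2) * (2 * (k + 5) / c * n)) * Real.exp (2 * n) := by gcongr
    _ = Real.exp (-((k + 3) * n)) := by
        rw [← Real.exp_add]
        congr 1
        field_simp
        ring
    _ ≤ Real.exp (-((k + 3) * Real.log n)) := by gcongr
    _ ≤ _ := by linarith [Real.exp_pos (-((k + 3) * Real.log n))]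

end Events

end Main

theorem proposition3p2 (c₀ k : ℝ) (hc₀ : 0 < c₀) (hk : 0 < k) :
    ∃ C B : ℝ, 0 < C ∧ 0 < B ∧
      ∀ (n d : ℕ), 1 ≤ n → c₀ * (n : ℝ) ≤ (d : ℝ) →
      ∀ (Ω : Type*) [MeasurableSpace Ω] (μ : Measure Ω) [IsProbabilityMeasure μ]
        (x : Fin n → Ω → EuclideanSpace ℝ (Fin d)),
        (∀ a, Measurable (x a)) →
        iIndepFun x μ →
        (∀ a, ∫ ω, x a ω ∂μ = 0) →
        (∀ a, ∫ ω, ‖x a ω‖ ^ 2 ∂μ = 1) →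
        (∀ a, ConvexConcentration μ c₀ (fun ω => Real.sqrt (d : ℝ) • x a ω)) →
        1 - (n : ℝ) ^ (-k) ≤
          μ.real {ω | IsApproxOrthonormal (Real.sqrt (C * Real.log (n : ℝ) / (d : ℝ))) B
            (columnMatrix fun a => x a ω)} := by
  let K := (k + 4) / c₀
  let R := 1 + √(K / c₀)
  let V := 6 / c₀
  let M := 52 / c₀ * ((k + 5) / c₀ + 2)
  let L := 2 * (k + 5) / c₀
  let C := ((R + 1) * (√K + 2 * V)) ^ 2 + (k + 5) * R ^ 2 / c₀
  have hK : 0 < K := by positivity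
  have hR : 0 < R := by positivity
  have hV : 0 < V := by positivity
  have hM : 0 < M := by positivity
  have hL : 0 < L := by positivity
  have hC : 0 < C := by positivity
  refine ⟨C, 4 * √M + √(2 * (R + 1) ^ 2 * (L + V ^ 2) / c₀), hC, by positivity, ?_⟩
  intro n d hn hd Ω _ μ _ x hxm hind hmean hsq hconc
  rcases hn.eq_or_lt with rfl | hn2
  · simp
  replace hn2 : 2 ≤ n := hn2
  have hd0 : (0 : ℝ) ≤ d := Nat.cast_nonneg d
  let Y : Fin n → Ω → EuclideanSpace ℝ (Fin d) := fun a ω => √(d : ℝ) • x a ω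
  have hYm : ∀ a, Measurable (Y a) := fun a => by have := hxm a; fun_prop
  have hYind : iIndepFun Y μ :=
    hind.comp (fun _ y => √(d : ℝ) • y) fun _ => measurable_const_smul _
  have hYx : ∀ a b, a ≠ b → IndepFun (Y a) (x b) μ := fun a b hab =>
    (hind.indepFun hab).comp (measurable_const_smul (√(d : ℝ))) measurable_id
  have hxsq : ∀ a, Integrable (fun ω => ‖x a ω‖ ^ 2) μ := fun a =>
    Integrable.of_integral_ne_zero (by rw [hsq a]; exact one_ne_zero)
  have hxint : ∀ a, Integrable (x a) μ := fun a =>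
    ((memLp_two_iff_integrable_sq_norm (hxm a).aestronglyMeasurable).2 (hxsq a)).integrable
      one_le_two
  have hYint : ∀ a, Integrable (Y a) μ := fun a => (hxint a).smul √(d : ℝ)
  have hYmean : ∀ a, ∫ ω, Y a ω ∂μ = 0 := fun a => by
    simp only [Y]
    rw [integral_smul, hmean a, smul_zero]
  have hYnorm : ∀ a ω, ‖Y a ω‖ = √d * ‖x a ω‖ := fun a ω => by
    rw [norm_smul, Real.norm_of_nonneg (Real.sqrt_nonneg _)]
  have hYsq : ∀ a ω, ‖Y a ω‖ ^ 2 = d * ‖x a ω‖ ^ 2 := fun a ω => by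
    rw [hYnorm, mul_pow, Real.sq_sqrt hd0]
  have hvar : ∀ a, (d : ℝ) - (∫ ω, ‖Y a ω‖ ∂μ) ^ 2 ∈ Set.Icc 0 V := fun a => by
    have h := sub_sq_integral_norm_mem_Icc hc₀ (hYm a)
      (by simp only [hYsq]; exact (hxsq a).const_mul _) (hconc a)
    simp only [hYsq] at h
    rwa [integral_const_mul, hsq a, mul_one] at h
  have h1 := measureReal_exists_norm_deviation_le hn2 hc₀ hk hconc
  have h2 := measureReal_exists_inner_gt_le (k := k) (C := C) hn2 hxm hYm hYx hYint hYmean hconc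
    hR hC (by
      have : c₀ * C = c₀ * ((R + 1) * (√K + 2 * V)) ^ 2 + (k + 5) * R ^ 2 := by
        simp only [C]; field_simp
      rw [this]
      exact le_add_of_nonneg_left (by positivity))
  have h3 := measureReal_norm_columnMatrix_gt_le_rpow hn2 hc₀ hk hd hYind hYint hYmean hconc
  have h4 := measureReal_sum_norm_deviation_gt_le hn2 hc₀ hk hYm hYind hconc
  set E1 := {ω | ∃ a, √((k + 4) / c₀ * Real.log n) ≤ |‖Y a ω‖ - ∫ ω', ‖Y a ω'‖ ∂μ|}
  set E2 := {ω | ∃ a b, a ≠ b ∧ √(C * Real.log n) ≤ |inner ℝ (x b ω) (Y a ω)| ∧ ‖x b ω‖ ≤ R}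
  open scoped Matrix.Norms.L2Operator in
  set E3 := {ω | 4 * √(M * d) < ‖columnMatrix fun a => Y a ω‖}
  set E4 := {ω | L * n ≤ ∑ a, (‖Y a ω‖ - ∫ ω', ‖Y a ω'‖ ∂μ) ^ 2}
  set G := {ω | IsApproxOrthonormal (√(C * Real.log n / d))
    (4 * √M + √(2 * (R + 1) ^ 2 * (L + V ^ 2) / c₀)) (columnMatrix fun a => x a ω)}
  have hcover : (Set.univ : Set Ω) ⊆ G ∪ (E1 ∪ (E2 ∪ (E3 ∪ E4))) := by
    intro ω _
    by_contra hω
    simp only [Set.mem_union, not_or] at hω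
    obtain ⟨hG, hE1, hE2, hE3, hE4⟩ := hω
    simp only [E1, Set.mem_ofPred_eq, not_exists, not_le] at hE1
    simp only [E2, Set.mem_ofPred_eq, not_exists, not_and] at hE2
    simp only [E3, Set.mem_ofPred_eq, not_lt] at hE3
    simp only [E4, Set.mem_ofPred_eq, not_le] at hE4
    refine hG (isApproxOrthonormal_of_deviation_le hn2 hc₀ hK.le hV.le hM.le hL.le
      (le_add_of_nonneg_right (by positivity)) hd (m := fun a => ∫ ω, ‖Y a ω‖ ∂μ)
      (fun a => integral_nonneg fun _ => norm_nonneg _) hvar (fun a => ?_)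
      (fun a b hab hb => ?_) hE3 ?_)
    · rw [← hYnorm]
      exact (hE1 a).le
    · by_contra! hcon
      exact hE2 a b hab hcon.le hb
    · simp only [← hYnorm]
      exact hE4.le
  have huniv : (1 : ℝ) ≤ μ.real (G ∪ (E1 ∪ (E2 ∪ (E3 ∪ E4)))) := by
    rw [← probReal_univ (μ := μ)]
    exact measureReal_mono hcover (measure_ne_top _ _)
  have u1 := measureReal_union_le (μ := μ) G (E1 ∪ (E2 ∪ (E3 ∪ E4)))
  have u2 := measureReal_union_le (μ := μ) E1 (E2 ∪ (E3 ∪ E4))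
  have u3 := measureReal_union_le (μ := μ) E2 (E3 ∪ E4)
  have u4 := measureReal_union_le (μ := μ) E3 E4
  linarith
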